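/- Let $X$ and $Z$ be real Hausdorff locally convex topological vector spaces. Let $C\subseteq Z$ be a convex pointed cone with nonempty interior, that is, $tc\in C$ for all $c\in C$, $t\ge 0$, $C+C=C$, $C\cap(-C)=\{0\}$ and $\operatorname{int}C\neq\emptyset$. Let $K\subseteq X$ be nonempty, convex and closed, and let $D\subseteq K$ be self segment-dense in $K$: $K\subseteq\operatorname{cl}D$, and for all $x,y\in D$ the set $[x,y]\cap D$ is dense in the closed segment $[x,y]$. Let $f:K\times K\to Z$ satisfy: (i) for every $y\in D$, the map $x\mapsto f(x,y)$ is $C$-upper semicontinuous at every point of $K$; (ii) for every $x\in K$, the map $y\mapsto f(x,y)$, defined on $K$, is $C$-upper semicontinuous at every point of $K\setminus D$; (iii) for every $x\in D$, the map $y\mapsto f(x,y)$ is $C$-convex on $D$; (iv) $f(x,x)\notin-\operatorname{int}C$ for every $x\in D$; (v) there exist a compact set $K_0\subseteq X$ and a point $y_0\in D$ such that $f(x,y_0)\in-\operatorname{int}C$ for all $x\in K\setminus K_0$. Then there exists $x_0\in K$ such that $f(x_0,y)\notin-\operatorname{int}C$ for all $y\in K$. Here a map $g:K\to Z$ is called $C$-upper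 semicontinuous at $x\in K$ if for every neighborhood $V$ of $g(x)$ there is a neighborhood $U$ of $x$ such that $g(u)\in V-C$ for all $u\in U\cap K$. It is called $C$-convex on $D$ if for all $n\in\mathbb N$, $x_1,\dots,x_n\in D$ and $\lambda_1,\dots,\lambda_n\ge 0$ with $\sum_{i}\lambda_i=1$ and $\sum_{i}\lambda_i x_i\in D$ one has $\sum_{i}\lambda_i g(x_i)-g\bigl(\sum_{i}\lambda_i x_i\bigr)\in C$. -/

import Mathlib

open scoped Topology Pointwise

/-- A convex pointed cone in a real vector space, in the sense of vector optimization: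
`t • c ∈ C` for all `c ∈ C`, `t ≥ 0`; `C + C = C`; and `C ∩ (-C) = {0}`. -/
structure IsConvexPointedCone {Z : Type*} [AddCommGroup Z] [Module ℝ Z] (C : Set Z) : Prop where
  smul_mem : ∀ c ∈ C, ∀ t : ℝ, 0 ≤ t → t • c ∈ C
  add_eq : C + C = C
  pointed : C ∩ (-C) = {0}

/-- `U` is self segment-dense in the (convex) set `V`: `U ⊆ V`, `U` is dense in `V`, and for all
`x, y ∈ U` the set `[x, y] ∩ U` is dense in the closed segment `[x, y]`. -/
structure IsSelfSegmentDense {X : Type*} [AddCommGroup X] [Module ℝ X] [TopologicalSpace X]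
    (U V : Set X) : Prop where
  subset : U ⊆ V
  dense : V ⊆ closure U
  segment_dense : ∀ x ∈ U, ∀ y ∈ U, segment ℝ x y ⊆ closure (segment ℝ x y ∩ U)

/-- `C`-upper semicontinuity at `x` of a map `g` considered on the set `K` only:
for every neighborhood `V` of `g x` there is a neighborhood `U` of `x` such that
`g u ∈ V - C` for all `u ∈ U ∩ K`. The values of `g` outside `K ∪ {x}` play no role. -/
def ConeUpperSemicontinuousAt {X Z : Type*} [TopologicalSpace X] [TopologicalSpace Z]
    [AddCommGroup Z] (C : Set Z) (K : Set X) (g : X → Z) (x : X) : Prop :=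
  ∀ V ∈ 𝓝 (g x), ∃ U ∈ 𝓝 x, ∀ u ∈ U ∩ K, g u ∈ V - C

/-- `C`-convexity of `g` on a set `D` that need not be convex: whenever a convex combination
`∑ lᵢ xᵢ` of points of `D` lies in `D`, one has `g (∑ lᵢ xᵢ) ≤ ∑ lᵢ g (xᵢ)` in the order induced
by `C` (that is, `z₁ ≤ z₂` iff `z₂ - z₁ ∈ C`). -/
def ConeConvexOn {X Z : Type*} [AddCommGroup X] [Module ℝ X] [AddCommGroup Z] [Module ℝ Z]
    (C : Set Z) (D : Set X) (g : X → Z) : Prop :=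
  ∀ (n : ℕ) (x : Fin n → X) (l : Fin n → ℝ), (∀ i, x i ∈ D) → (∀ i, 0 ≤ l i) →
    ∑ i, l i = 1 → ∑ i, l i • x i ∈ D →
      ∑ i, l i • g (x i) - g (∑ i, l i • x i) ∈ C

/-! For y in D let G y be the set of x in K with f x y outside -int C. A point x₀ common to all G y
is a solution: (ii) and the density of D carry the conclusion from D to K. By (i) each G y is
closed, and coercivity reduces the claim, by compactness, to finite intersections; these are
nonempty by the KKM lemma. Its covering condition follows from (iii) and (iv) at points of D and
passes to closures, as segment-density makes D dense in convex hulls of its subsets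
(`convexHull_subset_closure_inter`).

KKM rests on the absence of C¹ retractions f of a ball onto its sphere. For small t > 0 the map x +
t(f x - x) permutes the ball, so its Jacobian integrates to the ball's volume. That integral is
polynomial in t, so the same holds at t = 1, where the Jacobian is identically zero. -/

open scoped ContDiff Manifold

/-! ### Polynomial dependence on t and extrapolation -/

/-- The determinant of `1 + t • A` is a polynomial in `t` of degree at most the dimension. -/
theorem LinearMap.exists_polynomial_det_one_add_smul {E : Type*} [AddCommGroup E] [Module ℝ E]
    [FiniteDimensional ℝ E] (A : E →ₗ[ℝ] E) :
    ∃ p : Polynomial ℝ, p.natDegree ≤ Module.finrank ℝ E ∧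
      ∀ t : ℝ, LinearMap.det (1 + t • A) = p.eval t := by
  let b := Module.finBasis ℝ E
  let M := LinearMap.toMatrix b b A
  refine ⟨((Polynomial.X : Polynomial ℝ) • M.map Polynomial.C +
    (1 : Matrix _ _ ℝ).map Polynomial.C).det, ?_, fun t => ?_⟩
  · simpa using Polynomial.natDegree_det_X_add_C_le M 1
  · rw [← Polynomial.coe_evalRingHom, RingHom.map_det, ← LinearMap.det_toMatrix b, map_add, map_smul,
      show (1 : E →ₗ[ℝ] E) = LinearMap.id from rfl, LinearMap.toMatrix_id]
    congr 1
    ext i j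
    by_cases hij : i = j <;> simp [hij, M, mul_comm t, add_comm]

/-- Polynomials of degree at most `n` can be extrapolated linearly from nodes in `(0, ε]`. -/
theorem Polynomial.exists_extrapolation (n : ℕ) {ε : ℝ} (hε : 0 < ε) (s : ℝ) :
    ∃ c τ : ℕ → ℝ, (∀ k, 0 < τ k ∧ τ k ≤ ε) ∧ ∀ p : Polynomial ℝ, p.natDegree ≤ n →
      p.eval s = ∑ k ∈ Finset.range (n + 1), c k * p.eval (τ k) := by
  let τ : ℕ → ℝ := fun k => ε / (k + 1)
  have hτ : Function.Injective τ := by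
    intro a b hab
    have h1 : (a : ℝ) + 1 ≠ 0 := by positivity
    have h2 : (b : ℝ) + 1 ≠ 0 := by positivity
    simp only [τ] at hab
    field_simp at hab
    exact_mod_cast (by linarith : (a : ℝ) = b)
  refine ⟨fun k => (Lagrange.basis (Finset.range (n + 1)) τ k).eval s, τ,
    fun k => ⟨by positivity, div_le_self hε.le (by simp)⟩, fun p hp => ?_⟩
  have hdeg : p.degree < (Finset.range (n + 1)).card := by
    rw [Finset.card_range]
    exact lt_of_le_of_lt Polynomial.degree_le_natDegree (by exact_mod_cast Nat.lt_succ_of_le hp)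
  conv_lhs => rw [Lagrange.eq_interpolate hτ.injOn hdeg]
  simp [Lagrange.interpolate_apply, Polynomial.eval_finsetSum, mul_comm]

/-! ### The no-retraction theorem by volume -/

section NoRetraction

variable {E : Type*} [NormedAddCommGroup E] [InnerProductSpace ℝ E]

/-- Cutting off at the ball a Lipschitz map that vanishes on the sphere gives a Lipschitz map. -/
theorem LipschitzOnWith.indicator_closedBall {h : E → E} {r : ℝ} (hr : 0 < r) {L : NNReal}
    (hL : LipschitzOnWith L h (Metric.closedBall 0 r)) (h0 : ∀ x, ‖x‖ = r → h x = 0) :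
    LipschitzWith (2 * L) ((Metric.closedBall 0 r).indicator h) := by
  have key : ∀ x y : E, ‖x‖ ≤ r → r < ‖y‖ → ‖h x‖ ≤ 2 * L * ‖x - y‖ := by
    intro x y hx hy
    have hy0 : 0 < ‖y‖ := hr.trans hy
    -- The radial projection z of y has h z = 0 and ‖y - z‖ = ‖y‖ - r ≤ ‖x - y‖; hence the factor 2.
    let z : E := (r / ‖y‖) • y
    have hz : ‖z‖ = r := by
      simp only [z, norm_smul, norm_div, norm_norm, Real.norm_of_nonneg hr.le]
      field_simp
    have hyz : ‖y - z‖ = ‖y‖ - r := by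
      have : y - z = (1 - r / ‖y‖) • y := by simp [z, sub_smul]
      rw [this, norm_smul, Real.norm_eq_abs, abs_of_nonneg]
      · field_simp
      · rw [sub_nonneg, div_le_one hy0]; exact hy.le
    have h1 := hL.norm_sub_le (x := x) (y := z) (by simpa using hx) (by simp [hz])
    rw [h0 z hz, sub_zero] at h1
    have h2 : ‖x - z‖ ≤ 2 * ‖x - y‖ := by
      have h3 := norm_sub_le_norm_sub_add_norm_sub x y z
      have h4 := norm_sub_norm_le y x
      rw [norm_sub_rev y x] at h4
      linarith
    calc ‖h x‖ ≤ L * ‖x - z‖ := h1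
      _ ≤ L * (2 * ‖x - y‖) := by gcongr
      _ = 2 * L * ‖x - y‖ := by ring
  refine LipschitzWith.of_dist_le_mul fun x y => ?_
  rw [dist_eq_norm, dist_eq_norm]
  push_cast
  by_cases hx : ‖x‖ ≤ r <;> by_cases hy : ‖y‖ ≤ r
  · rw [Set.indicator_of_mem (by simpa using hx), Set.indicator_of_mem (by simpa using hy)]
    have := hL.norm_sub_le (x := x) (y := y) (by simpa using hx) (by simpa using hy)
    have h2 : 0 ≤ L * ‖x - y‖ := by positivity
    linarith
  · rw [Set.indicator_of_mem (by simpa using hx), Set.indicator_of_notMem (by simpa using hy),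
      sub_zero]
    exact key x y hx (not_le.1 hy)
  · rw [Set.indicator_of_notMem (by simpa using hx), Set.indicator_of_mem (by simpa using hy),
      zero_sub, norm_neg, norm_sub_rev]
    exact key y x hy (not_le.1 hx)
  · rw [Set.indicator_of_notMem (by simpa using hx), Set.indicator_of_notMem (by simpa using hy)]
    simp only [sub_self, norm_zero]; positivity

variable [FiniteDimensional ℝ E]

/-- Small Lipschitz perturbations of the identity that vanish on the sphere permute the ball, as
long as they do not leave it. -/
theorem bijOn_closedBall_add_smul {h : E → E} {r : ℝ} (hr : 0 < r) {L : NNReal}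
    (hL : LipschitzOnWith L h (Metric.closedBall 0 r)) (h0 : ∀ x, ‖x‖ = r → h x = 0)
    {t : ℝ} (ht : 0 ≤ t) (htL : t * (2 * L) < 1)
    (hmaps : Set.MapsTo (fun x => x + t • h x) (Metric.closedBall 0 r) (Metric.closedBall 0 r)) :
    Set.BijOn (fun x => x + t • h x) (Metric.closedBall 0 r) (Metric.closedBall 0 r) := by
  set H := (Metric.closedBall (0 : E) r).indicator h with hH
  have hHL : LipschitzWith (2 * L) H := hL.indicator_closedBall hr h0
  let c : NNReal := Real.toNNReal t * (2 * L)
  have hc : c < 1 := by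
    rw [← NNReal.coe_lt_coe]; simpa [c, ht] using htL
  -- The identity plus a map of Lipschitz constant below 1 is a bijection of the whole space.
  have happ : ApproximatesLinearOn (fun x => x + t • H x)
      ((ContinuousLinearEquiv.refl ℝ E : E ≃L[ℝ] E) : E →L[ℝ] E) Set.univ c := by
    intro x _ y _
    have : x + t • H x - (y + t • H y) -
        ((ContinuousLinearEquiv.refl ℝ E : E ≃L[ℝ] E) : E →L[ℝ] E) (x - y) =
        t • (H x - H y) := by
      simp [smul_sub]; abel
    rw [this, norm_smul, Real.norm_of_nonneg ht]
    have := hHL.norm_sub_le x y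
    calc t * ‖H x - H y‖ ≤ t * (↑(2 * L) * ‖x - y‖) := by gcongr
      _ = c * ‖x - y‖ := by simp [c, mul_assoc, ht]
  have hcE : Subsingleton E ∨ c < ‖((ContinuousLinearEquiv.refl ℝ E : E ≃L[ℝ] E).symm :
      E →L[ℝ] E)‖₊⁻¹ := by
    rcases subsingleton_or_nontrivial E with hE | hE
    · exact Or.inl hE
    · right
      have : ‖((ContinuousLinearEquiv.refl ℝ E : E ≃L[ℝ] E).symm : E →L[ℝ] E)‖₊ = 1 := by
        simp
      rw [this, inv_one]; exact hc
  have heq : ∀ x ∈ Metric.closedBall (0 : E) r, x + t • h x = x + t • H x := fun x hx => by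
    rw [hH, Set.indicator_of_mem hx]
  refine ⟨hmaps, ?_, ?_⟩
  · intro x hx y hy hxy
    have hinj := Set.injOn_univ.1 (Set.injOn_iff_injective.2 (happ.injective hcE))
    apply hinj
    simp only at hxy ⊢
    rw [← heq x hx, ← heq y hy, hxy]
  · intro y hy
    obtain ⟨x, hx⟩ := happ.surjective hcE y
    simp only at hx
    by_cases hxr : x ∈ Metric.closedBall (0 : E) r
    · exact ⟨x, hxr, by simpa [heq x hxr] using hx⟩
    -- Points outside the ball are fixed, so none of them can map into it.
    · have : H x = 0 := Set.indicator_of_notMem hxr _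
      rw [this, smul_zero, add_zero] at hx
      exact absurd (hx ▸ hy) hxr

/-- There is no `C¹` retraction of a ball onto its sphere (Milnor–Rogers). -/
theorem not_exists_contDiff_retraction_sphere {r : ℝ} (hr : 0 < r) {f : E → E}
    (hf : ContDiff ℝ 1 f) (hfix : ∀ x, ‖x‖ = r → f x = x) (hnorm : ∀ x, ‖f x‖ = r) : False := by
  borelize E
  set B := Metric.closedBall (0 : E) r with hB
  have hBc : IsCompact B := isCompact_closedBall 0 r
  set μ : MeasureTheory.Measure E := MeasureTheory.volume
  let h : E → E := fun x => f x - x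
  let A : E → E →L[ℝ] E := fun x => fderiv ℝ f x - 1
  have hh : ContDiff ℝ 1 h := hf.sub contDiff_id
  have hA : ∀ x, HasFDerivAt h (A x) x := fun x =>
    (hf.differentiable one_ne_zero x).hasFDerivAt.sub (hasFDerivAt_id x)
  have hAcont : Continuous A := (hf.continuous_fderiv one_ne_zero).sub continuous_const
  obtain ⟨L, hL⟩ := hh.contDiffOn.exists_lipschitzOnWith (s := B) one_ne_zero
    (convex_closedBall 0 r) hBc
  have hh0 : ∀ x, ‖x‖ = r → h x = 0 := fun x hx => by simp [h, hfix x hx]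
  obtain ⟨M, hM⟩ := hBc.exists_bound_of_continuousOn hAcont.continuousOn
  have hM0 : 0 ≤ M := (norm_nonneg _).trans (hM 0 (by simp [hB, hr.le]))
  have hdet_cont : Continuous fun T : E →L[ℝ] E => T.det := ContinuousLinearMap.continuous_det
  have hdet_nhds : ∀ᶠ T : E →L[ℝ] E in 𝓝 1, 0 < T.det :=
    hdet_cont.continuousAt.eventually (lt_mem_nhds (by
      simp [ContinuousLinearMap.det]))
  obtain ⟨δ, hδ, hδdet⟩ := Metric.eventually_nhds_iff.1 hdet_nhds
  -- The three bounds keep the image in the ball, give bijectivity, and make the Jacobian positive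
  -- so that its absolute value can be dropped.
  obtain ⟨ε, hε, hε1, hεL, hεM⟩ : ∃ ε : ℝ, 0 < ε ∧ ε ≤ 1 ∧ ε * (2 * L) < 1 ∧ ε * M < δ := by
    have h1 : ∀ᶠ e : ℝ in 𝓝[>] 0, e ≤ 1 :=
      nhdsWithin_le_nhds (ge_mem_nhds one_pos)
    have h2 : ∀ᶠ e : ℝ in 𝓝[>] 0, e * (2 * L) < 1 := by
      refine nhdsWithin_le_nhds ?_
      exact (continuous_id.mul continuous_const).continuousAt.eventually
        (gt_mem_nhds (by simp))
    have h3 : ∀ᶠ e : ℝ in 𝓝[>] 0, e * M < δ := by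
      refine nhdsWithin_le_nhds ?_
      exact (continuous_id.mul continuous_const).continuousAt.eventually
        (gt_mem_nhds (by simpa using hδ))
    obtain ⟨e, he⟩ := (self_mem_nhdsWithin (a := (0 : ℝ)) (s := Set.Ioi 0)
      |> fun h0 => (Filter.Eventually.and h0 (h1.and (h2.and h3)))).exists
    exact ⟨e, he.1, he.2⟩
  have hvol : ∀ t : ℝ, 0 < t ∧ t ≤ ε →
      ∫ x in B, (1 + t • A x).det ∂μ = μ.real B := by
    intro t ⟨ht, htε⟩
    have hmaps : Set.MapsTo (fun x => x + t • h x) B B := by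
      intro x hx
      have hx' : ‖x‖ ≤ r := by simpa [hB] using hx
      have : x + t • h x = (1 - t) • x + t • f x := by
        simp only [h, smul_sub, sub_smul, one_smul]; abel
      simp only [hB, Metric.mem_closedBall, dist_zero_right]
      rw [this]
      calc ‖(1 - t) • x + t • f x‖ ≤ ‖(1 - t) • x‖ + ‖t • f x‖ := norm_add_le _ _
        _ = (1 - t) * ‖x‖ + t * r := by
          rw [norm_smul, norm_smul, hnorm, Real.norm_of_nonneg ht.le,
            Real.norm_of_nonneg (by linarith)]
        _ ≤ (1 - t) * r + t * r := by
          have : 0 ≤ 1 - t := by linarith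
          gcongr
        _ = r := by ring
    have htL : t * (2 * L) < 1 := lt_of_le_of_lt (by gcongr) hεL
    have hbij := bijOn_closedBall_add_smul hr hL hh0 ht.le htL hmaps
    have hder : ∀ x ∈ B, HasFDerivWithinAt (fun x => x + t • h x) (1 + t • A x) B x :=
      fun x _ => ((hasFDerivAt_id x).add ((hA x).const_smul t)).hasFDerivWithinAt
    have hint := MeasureTheory.integral_image_eq_integral_abs_det_fderiv_smul μ
      hBc.measurableSet hder hbij.injOn (fun _ => (1 : ℝ))
    rw [hbij.image_eq] at hint
    simp only [MeasureTheory.integral_const, MeasureTheory.measureReal_restrict_apply_univ, smul_eq_mul, mul_one] at hint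
    rw [hint]
    refine MeasureTheory.setIntegral_congr_fun hBc.measurableSet fun x hx => ?_
    refine (abs_of_pos (hδdet ?_)).symm
    rw [dist_eq_norm, add_sub_cancel_left, norm_smul, Real.norm_of_nonneg ht.le]
    exact lt_of_le_of_lt (mul_le_mul htε (hM x hx) (norm_nonneg _) hε.le) hεM
  have hdet_int : ∀ t : ℝ, MeasureTheory.IntegrableOn (fun x => (1 + t • A x).det) B μ := by
    intro t
    have hcont : Continuous fun x => 1 + t • A x := continuous_const.add (hAcont.const_smul t)
    exact (hdet_cont.comp hcont).continuousOn.integrableOn_compact hBc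
  obtain ⟨c, τ, hτ, hcτ⟩ := Polynomial.exists_extrapolation (Module.finrank ℝ E) hε 1
  have hdet : ∀ x, (1 + (1 : ℝ) • A x).det =
      ∑ k ∈ Finset.range (Module.finrank ℝ E + 1), c k * (1 + τ k • A x).det := by
    intro x
    obtain ⟨p, hp, hpe⟩ := LinearMap.exists_polynomial_det_one_add_smul (A x : E →ₗ[ℝ] E)
    have hpe' : ∀ t : ℝ, (1 + t • A x).det = p.eval t := fun t => hpe t
    simp only [hpe', hcτ p hp]
  -- Extrapolation of the constant polynomial 1.
  have hone : ∑ k ∈ Finset.range (Module.finrank ℝ E + 1), c k = 1 := by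
    simpa using (hcτ 1 (by simp)).symm
  have hint : ∫ x in B, (1 + (1 : ℝ) • A x).det ∂μ = μ.real B := by
    simp only [hdet]
    rw [MeasureTheory.integral_finsetSum]
    · simp only [MeasureTheory.integral_const_mul, hvol _ (hτ _)]
      rw [← Finset.sum_mul, hone, one_mul]
    · exact fun k _ => (hdet_int (τ k)).integrable.const_mul (c k)
  have hzero : ∀ x, (1 + (1 : ℝ) • A x).det = 0 := by
    intro x
    have hAx : 1 + (1 : ℝ) • A x = fderiv ℝ f x := by simp [A]
    rw [hAx]
    by_contra hne
    have hunit : IsUnit (fderiv ℝ f x : E →ₗ[ℝ] E) := by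
      rw [LinearMap.isUnit_iff_isUnit_det]; exact isUnit_iff_ne_zero.2 hne
    -- Differentiating ‖f‖² = r² along v gives 2⟪f x, f x⟫ = 0, which is impossible.
    obtain ⟨v, hv⟩ := ((Module.End.isUnit_iff _).1 hunit).2 (f x)
    have hd := (hf.differentiable one_ne_zero x).hasFDerivAt
    have h1 := hd.inner ℝ hd
    have h2 : (fun y => inner ℝ (f y) (f y)) = fun _ => r ^ 2 := by
      funext y; rw [real_inner_self_eq_norm_sq, hnorm]
    rw [h2] at h1
    have h3 := congrArg (fun T => T v) (h1.unique (hasFDerivAt_const _ _))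
    have hv' : fderiv ℝ f x v = f x := hv
    simp [hv', hnorm] at h3
    exact hr.ne' h3
  simp only [hzero, MeasureTheory.integral_zero] at hint
  have hpos : 0 < μ.real B :=
    ENNReal.toReal_pos (Metric.measure_closedBall_pos μ 0 hr).ne' hBc.measure_lt_top.ne
  exact hpos.ne hint

end NoRetraction

/-! ### The KKM lemma -/

/-- The Knaster–Kuratowski–Mazurkiewicz lemma in a Euclidean space. -/
theorem kkm_finiteDimensional {E ι : Type*} [NormedAddCommGroup E] [InnerProductSpace ℝ E]
    [FiniteDimensional ℝ E] [Finite ι] (v : ι → E) (F : ι → Set E) (hF : ∀ i, IsClosed (F i))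
    (hKKM : ∀ I : Set ι, convexHull ℝ (v '' I) ⊆ ⋃ i ∈ I, F i) : (⋂ i, F i).Nonempty := by
  by_contra hempty
  have hex : ∀ x, ∃ i, x ∉ F i := by
    intro x
    by_contra! hx
    exact hempty ⟨x, Set.mem_iInter.2 hx⟩
  obtain ⟨R, hR0, hR⟩ : ∃ R : ℝ, 0 < R ∧ ∀ i, ‖v i‖ ≤ R := by
    obtain ⟨R, hR⟩ := (Set.finite_range fun i => ‖v i‖).bddAbove
    exact ⟨max R 1, by positivity, fun i => (hR ⟨i, rfl⟩).trans (le_max_left _ _)⟩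
  let t : E → Set E := fun x => {y | ‖y‖ ≤ R ∧
    (‖x‖ ≤ R → y ∈ convexHull ℝ (v '' {i | x ∉ F i})) ∧ (2 * R ≤ ‖x‖ → y = 0)}
  have htconv : ∀ x, Convex ℝ (t x) := by
    intro x y hy z hz a b ha hb hab
    refine ⟨?_, fun hx => convex_convexHull ℝ _ (hy.2.1 hx) (hz.2.1 hx) ha hb hab, fun hx => ?_⟩
    · have := convex_closedBall (0 : E) R (by simpa using hy.1) (by simpa using hz.1) ha hb hab
      simpa using this
    · rw [hy.2.2 hx, hz.2.2 hx]; simp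
  have htloc : ∀ x, ∃ c : E, ∀ᶠ y in 𝓝 x, c ∈ t y := by
    intro x
    rcases le_or_gt ‖x‖ R with hx | hx
    · obtain ⟨i, hi⟩ := hex x
      refine ⟨v i, ?_⟩
      filter_upwards [(hF i).isOpen_compl.mem_nhds hi,
        continuous_norm.continuousAt.eventually (gt_mem_nhds (by linarith : ‖x‖ < 2 * R))]
        with y hy hy2
      exact ⟨hR i, fun _ => subset_convexHull ℝ _ ⟨i, hy, rfl⟩, fun h => absurd hy2 (not_lt.2 h)⟩
    · refine ⟨0, ?_⟩
      filter_upwards [continuous_norm.continuousAt.eventually (lt_mem_nhds hx)] with y hy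
      exact ⟨by simpa using hR0.le, fun h => absurd hy (not_lt.2 h), fun _ => rfl⟩
  obtain ⟨g, hg⟩ := exists_contMDiffMap_forall_mem_convex_of_local_const (n := 1)
    (I := 𝓘(ℝ, E)) htconv htloc
  have hgC : ContDiff ℝ 1 g := g.contMDiff.contDiff
  have hne : ∀ x, x - g x ≠ 0 := by
    intro x hx
    have hxg : x = g x := sub_eq_zero.1 hx
    have hxR : ‖x‖ ≤ R := by rw [hxg]; exact (hg x).1
    have hmem := (hg x).2.1 hxR
    rw [← hxg] at hmem
    obtain ⟨i, hi, hxi⟩ := Set.mem_iUnion₂.1 (hKKM _ hmem)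
    exact hi hxi
  have hψ : ContDiff ℝ 1 fun x => x - g x := contDiff_id.sub hgC
  have hnorm : ContDiff ℝ 1 fun x => (2 * R) * ‖x - g x‖⁻¹ :=
    contDiff_const.mul ((hψ.norm ℝ hne).inv fun x => norm_ne_zero_iff.2 (hne x))
  -- Normalizing x - g x to length 2R gives the forbidden retraction.
  refine not_exists_contDiff_retraction_sphere (r := 2 * R) (by positivity) (hnorm.smul hψ) ?_ ?_
  · intro x hx
    have : g x = 0 := (hg x).2.2 hx.ge
    simp only [Pi.smul_apply', this, sub_zero, hx]
    rw [mul_inv_cancel₀ (by positivity), one_smul]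
  · intro x
    have h0 : ‖x - g x‖ ≠ 0 := norm_ne_zero_iff.2 (hne x)
    rw [Pi.smul_apply', norm_smul, norm_mul, norm_inv, norm_norm, mul_assoc, inv_mul_cancel₀ h0, mul_one,
      Real.norm_of_nonneg (by positivity)]

/-- The Knaster–Kuratowski–Mazurkiewicz lemma for finitely many points of a topological vector
space. -/
theorem kkm_finite {X ι : Type*} [AddCommGroup X] [Module ℝ X] [TopologicalSpace X]
    [IsTopologicalAddGroup X] [ContinuousSMul ℝ X] [Finite ι] (y : ι → X) (G : ι → Set X)
    (hG : ∀ i, IsClosed (G i)) (hKKM : ∀ I : Set ι, convexHull ℝ (y '' I) ⊆ ⋃ i ∈ I, G i) :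
    (⋂ i, G i).Nonempty := by
  classical
  have := Fintype.ofFinite ι
  let T : EuclideanSpace ℝ ι →ₗ[ℝ] X :=
    (Fintype.linearCombination ℝ y) ∘ₗ (WithLp.linearEquiv 2 ℝ (ι → ℝ)).toLinearMap
  have hT : Continuous T := by
    have : ⇑T = fun x : EuclideanSpace ℝ ι => ∑ i, x i • y i := by
      funext x; simp [T, Fintype.linearCombination_apply]
    rw [this]
    fun_prop
  have hTv : ∀ i, T (EuclideanSpace.single i 1) = y i := fun i => by
    simp [T, Fintype.linearCombination_apply, Pi.single_apply]
  obtain ⟨x, hx⟩ := kkm_finiteDimensional (fun i => EuclideanSpace.single i (1 : ℝ))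
    (fun i => T ⁻¹' G i) (fun i => (hG i).preimage hT) (fun I x hx => by
      have h1 : T x ∈ T '' convexHull ℝ _ := ⟨x, hx, rfl⟩
      rw [T.image_convexHull, Set.image_image] at h1
      simp only [hTv] at h1
      simpa using hKKM I h1)
  exact ⟨T x, by simpa using hx⟩

/-! ### Segment-density and convex hulls -/

/-- The set of points of a self segment-dense set in a convex set `P` has a convex closure. -/
theorem convex_closure_inter_of_segment_dense {X : Type*} [AddCommGroup X] [Module ℝ X]
    [TopologicalSpace X] [IsTopologicalAddGroup X] [ContinuousSMul ℝ X] {D P : Set X}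
    (hD : ∀ x ∈ D, ∀ y ∈ D, segment ℝ x y ⊆ closure (segment ℝ x y ∩ D)) (hP : Convex ℝ P) :
    Convex ℝ (closure (P ∩ D)) := by
  intro x hx y hy a b ha hb hab
  rw [← closure_closure]
  refine map_mem_closure₂ (f := fun x y => a • x + b • y) (by fun_prop) hx hy ?_
  intro u hu w hw
  exact closure_mono (Set.inter_subset_inter_left D (hP.segment_subset hu.1 hw.1))
    (hD u hu.2 w hw.2 ⟨a, b, ha, hb, hab, rfl⟩)

/-- Convex hulls of subsets of a self segment-dense set meet that set in a dense set. -/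
theorem convexHull_subset_closure_inter {X : Type*} [AddCommGroup X] [Module ℝ X]
    [TopologicalSpace X] [IsTopologicalAddGroup X] [ContinuousSMul ℝ X] {D S : Set X}
    (hD : ∀ x ∈ D, ∀ y ∈ D, segment ℝ x y ⊆ closure (segment ℝ x y ∩ D)) (hS : S ⊆ D) :
    convexHull ℝ S ⊆ closure (convexHull ℝ S ∩ D) :=
  convexHull_min (fun _ hs => subset_closure ⟨subset_convexHull ℝ S hs, hS hs⟩)
    (convex_closure_inter_of_segment_dense hD (convex_convexHull ℝ S))

/-! ### Cones and maps ordered by them -/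

namespace IsConvexPointedCone

variable {Z : Type*} [AddCommGroup Z] [Module ℝ Z] {C : Set Z}

theorem add_mem (hC : IsConvexPointedCone C) {a b : Z} (ha : a ∈ C) (hb : b ∈ C) : a + b ∈ C :=
  hC.add_eq ▸ Set.add_mem_add ha hb

theorem convex (hC : IsConvexPointedCone C) : Convex ℝ C :=
  fun x hx y hy a b ha hb _ => hC.add_mem (hC.smul_mem x hx a ha) (hC.smul_mem y hy b hb)

/-- `interior C + C` is open and contained in C + C = C. -/
theorem add_mem_interior [TopologicalSpace Z] [IsTopologicalAddGroup Z]
    (hC : IsConvexPointedCone C) {a b : Z} (ha : a ∈ interior C) (hb : b ∈ C) :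
    a + b ∈ interior C := by
  have : interior C + C ⊆ interior C :=
    interior_maximal ((Set.add_subset_add_right interior_subset).trans hC.add_eq.subset)
      isOpen_interior.add_right
  exact this (Set.add_mem_add ha hb)

end IsConvexPointedCone

/-- A `C`-upper semicontinuous map that has a value in `-int C` keeps its values there nearby. -/
theorem ConeUpperSemicontinuousAt.eventually_mem {X Z : Type*} [TopologicalSpace X]
    [AddCommGroup Z] [Module ℝ Z] [TopologicalSpace Z] [IsTopologicalAddGroup Z]
    {C : Set Z} (hC : IsConvexPointedCone C) {K : Set X} {g : X → Z} {x : X}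
    (hg : ConeUpperSemicontinuousAt C K g x) (hx : g x ∈ -interior C) :
    ∀ᶠ u in 𝓝 x, u ∈ K → g u ∈ -interior C := by
  obtain ⟨U, hU, hUK⟩ := hg (-interior C) (isOpen_interior.neg.mem_nhds hx)
  filter_upwards [hU] with u hu huK
  obtain ⟨v, hv, c, hc, hvc⟩ := hUK u ⟨hu, huK⟩
  rw [← hvc]
  have := hC.add_mem_interior hv hc
  simpa [add_comm, sub_eq_add_neg] using this

/-- If a `C`-convex map takes values in `-int C` at some points of `D`, it does so at each convex
combination of them in `D`. -/
theorem ConeConvexOn.mem_neg_interior {X Z : Type*} [AddCommGroup X] [Module ℝ X]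
    [AddCommGroup Z] [Module ℝ Z] [TopologicalSpace Z] [IsTopologicalAddGroup Z]
    [ContinuousSMul ℝ Z] {C : Set Z} (hC : IsConvexPointedCone C) {D : Set X} {g : X → Z}
    (hg : ConeConvexOn C D g) {S : Set X} (hS : S ⊆ D) (hgS : ∀ s ∈ S, g s ∈ -interior C)
    {x : X} (hx : x ∈ convexHull ℝ S) (hxD : x ∈ D) : g x ∈ -interior C := by
  rw [mem_convexHull_iff_exists_fintype] at hx
  obtain ⟨κ, _, w, z, hw0, hw1, hz, rfl⟩ := hx
  let e := (Fintype.equivFin κ).symm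
  have hsum : ∑ i, w (e i) • z (e i) = ∑ k, w k • z k := e.sum_comp fun k => w k • z k
  have h1 := hg _ (fun i => z (e i)) (fun i => w (e i)) (fun i => hS (hz _)) (fun i => hw0 _)
    (by rw [e.sum_comp w, hw1]) (by rwa [hsum])
  rw [hsum] at h1
  have h2 : ∑ i, w (e i) • g (z (e i)) ∈ -interior C :=
    hC.convex.interior.neg.sum_mem (fun i _ => hw0 _) (by rw [e.sum_comp w, hw1])
      (fun i _ => hgS _ (hz _))
  have h3 := hC.add_mem_interior h2 h1
  rw [Set.mem_neg]
  simpa only [neg_add_cancel_left, neg_add_eq_sub, sub_sub_cancel_left] using h3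

/-! ### The equilibrium theorem -/

/-- Existence of a solution of the weak vector equilibrium problem on a closed convex set `K`.
The bifunction is written as a total function `f : X → X → Z`, but every hypothesis and the
conclusion only involve its values on `K × K`. -/
theorem theoremt11 {X Z : Type*}
    [AddCommGroup X] [Module ℝ X] [TopologicalSpace X] [IsTopologicalAddGroup X]
    [ContinuousSMul ℝ X] [LocallyConvexSpace ℝ X] [T2Space X]
    [AddCommGroup Z] [Module ℝ Z] [TopologicalSpace Z] [IsTopologicalAddGroup Z]
    [ContinuousSMul ℝ Z] [LocallyConvexSpace ℝ Z] [T2Space Z]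
    (C : Set Z) (hC : IsConvexPointedCone C) (hCint : (interior C).Nonempty)
    (K : Set X) (hKne : K.Nonempty) (hKconv : Convex ℝ K) (hKclosed : IsClosed K)
    (D : Set X) (hD : IsSelfSegmentDense D K)
    (f : X → X → Z)
    (h_i : ∀ y ∈ D, ∀ x ∈ K, ConeUpperSemicontinuousAt C K (fun x' => f x' y) x)
    (h_ii : ∀ x ∈ K, ∀ y ∈ K \ D, ConeUpperSemicontinuousAt C K (fun y' => f x y') y)
    (h_iii : ∀ x ∈ D, ConeConvexOn C D (fun y => f x y))
    (h_iv : ∀ x ∈ D, f x x ∉ -interior C)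
    (h_v : ∃ K₀ : Set X, IsCompact K₀ ∧ ∃ y₀ ∈ D, ∀ x ∈ K \ K₀, f x y₀ ∈ -interior C) :
    ∃ x₀ ∈ K, ∀ y ∈ K, f x₀ y ∉ -interior C := by
  classical
  obtain ⟨K₀, hK₀, y₀, hy₀, hcoer⟩ := h_v
  let G : D → Set X := fun y => {x | x ∈ K ∧ f x y ∉ -interior C}
  have hGclosed : ∀ y, IsClosed (G y) := by
    intro y
    refine isClosed_iff_frequently.2 fun x hx => ?_
    have hxK : x ∈ K := isClosed_iff_frequently.1 hKclosed x (hx.mono fun _ h => h.1)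
    refine ⟨hxK, fun hmem => ?_⟩
    obtain ⟨u, hu, hu'⟩ := (hx.and_eventually
      ((h_i y y.2 x hxK).eventually_mem hC hmem)).exists
    exact hu.2 (hu' hu.1)
  have hKKM : ∀ I : Set D, I.Finite →
      convexHull ℝ ((fun y : D => (y : X)) '' I) ⊆ ⋃ y ∈ I, G y := by
    intro I hI
    have hID : (fun y : D => (y : X)) '' I ⊆ D := by
      rintro _ ⟨y, _, rfl⟩; exact y.2
    refine (convexHull_subset_closure_inter hD.segment_dense hID).trans ?_
    -- A finite union of closed sets is closed, so points of the hull lying in D suffice.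
    refine closure_minimal ?_ (hI.isClosed_biUnion fun y _ => hGclosed y)
    rintro x ⟨hx, hxD⟩
    by_contra hnot
    refine h_iv x hxD ((h_iii x hxD).mem_neg_interior hC hID ?_ hx hxD)
    rintro _ ⟨y, hy, rfl⟩
    by_contra hxy
    exact hnot (Set.mem_biUnion hy ⟨hD.subset hxD, hxy⟩)
  have hGfin : ∀ u : Finset D, (⋂ y ∈ u, G y).Nonempty := by
    intro u
    have := kkm_finite (fun y : u => ((y : D) : X)) (fun y => G y) (fun y => hGclosed y)
      (fun I x hx => by
        have h1 := hKKM (Subtype.val '' I) (I.toFinite.image _)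
          (by rwa [Set.image_image])
        simpa using h1)
    simpa [Set.iInter_subtype] using this
  obtain ⟨x₀, hx₀K₀, hx₀⟩ := hK₀.inter_iInter_nonempty G hGclosed (fun u => by
    -- Adding y₀ forces the common point into K₀.
    obtain ⟨x, hx⟩ := hGfin (insert ⟨y₀, hy₀⟩ u)
    simp only [Set.mem_iInter, Finset.mem_insert] at hx
    refine ⟨x, ?_, Set.mem_iInter₂.2 fun y hy => hx y (Or.inr hy)⟩
    have hxy₀ := hx _ (Or.inl rfl)
    by_contra hxK₀
    exact hxy₀.2 (hcoer x ⟨hxy₀.1, hxK₀⟩))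
  rw [Set.mem_iInter] at hx₀
  have hx₀K : x₀ ∈ K := (hx₀ ⟨y₀, hy₀⟩).1
  refine ⟨x₀, hx₀K, fun y hy hmem => ?_⟩
  by_cases hyD : y ∈ D
  · exact (hx₀ ⟨y, hyD⟩).2 hmem
  -- A value in -int C at y would persist at a nearby d in D.
  · obtain ⟨d, hd, hdD⟩ := mem_closure_iff_nhds.1 (hD.dense hy) _
      ((h_ii x₀ hx₀K y ⟨hy, hyD⟩).eventually_mem hC hmem)
    exact (hx₀ ⟨d, hdD⟩).2 (hd (hD.subset hdD))
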